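/- Let $\varphi(x,y)=(a+by-x^2,\,x)$ be the Hénon map on the Euclidean plane $\mathbb R^2$. (i) Let $a\in\mathbb R$, $b\neq 0$, $|b|<1$. At every point $(x,y)$ the Jacobian $D\varphi(x,y)$ has the singular values $$\sigma_1(x)=\tfrac12\Big(\sqrt{4x^2+(1+|b|)^2}+\sqrt{4x^2+(1-|b|)^2}\Big)\ge 1,\qquad \sigma_2(x)=\frac{|b|}{\sigma_1(x)}\le |b|.$$ For a nonempty closed bounded set $K\subset\mathbb R^2$ that is invariant ($\varphi^t(K)=K$ for all integers $t\ge 0$), put $\Phi(t,u)=D\varphi(\varphi^{t-1}(u))\cdots D\varphi(u)$, let $\sigma_1(t,u)\ge\sigma_2(t,u)>0$ be the singular values of $\Phi(t,u)$, and $\lambda_i(t,u)=\frac1t\ln\sigma_i(t,u)$ for $t\ge 1$. Let $\dim_{\rm L}(t,u)$ be $0$ if $\lambda_1<0$ (and hence $\lambda_1+\lambda_2<0$), $1+\lambda_1/|\lambda_2|$ if $\lambda_1\ge0>\lambda_1+\lambda_2$, and $2$ if $\lambda_1+\lambda_2\ge 0$ (the Kaplan–Yorke formula), and let the Lyapunov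 dimension of $K$ be $\dim_{\rm L}K=\liminf_{t\to\infty}\sup_{u\in K}\dim_{\rm L}(t,u)$. Let $\dim_{\rm H}$ be the Hausdorff dimension. (ii) Let $a>0$, $0<b<1$, $m=\frac{a(1+2b)}{1-b}$, $r=-\frac{1+\sqrt{1+4a}}2$, and let $\mathcal B=\overline M\setminus(Q\cup R_1\cup R_2)$ be Feit's region, where $$M=\{x<m,\ y<m+a\},\quad Q=\{x<r,\ y<0\},$$ $$R_1=\{x<-\sqrt{b(m+a)+a-r},\ y\le m+a\},\quad R_2=\{x\le m,\ y<-\tfrac1b(a+\sqrt{a+bm-r})\}.$$ Then every nonempty closed bounded invariant set $K\subseteq\mathcal B$ satisfies $$\dim_{\rm H}K\le\dim_{\rm L}K\le 1+\left(1-\frac{\ln b}{\ln\sigma_1\big(\max\{-r,\ m,\ \sqrt{b(m+a)+a-r}\}\big)}\right)^{-1}.$$ (iii) For $a=1.4$, $b=0.3$, every nonempty closed bounded invariant set $K\subseteq\mathcal B$ satisfies $\dim_{\rm H}K\le\dim_{\rm L}K\le 1.5319$. -/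

import Mathlib

open Filter

noncomputable section

namespace Henon

/-- The Euclidean plane. -/
abbrev Plane : Type := EuclideanSpace ℝ (Fin 2)

/-- The Hénon map `(x, y) ↦ (a + b y - x², x)`. -/
def henonMap (a b : ℝ) (u : Plane) : Plane :=
  !₂[a + b * u 1 - u 0 ^ 2, u 0]

/-- The `i`-th singular value of a linear map of the plane, in decreasing order and counted from
`i = 0`: the square roots of the eigenvalues of `A* A`, with multiplicity. -/
def sing (A : Plane →L[ℝ] Plane) (i : ℕ) : ℝ :=
  (A : Plane →ₗ[ℝ] Plane).singularValues i

/-- The fundamental matrix of the linearization along the orbit of `u`: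
`Φ(0, u) = I`, `Φ(t + 1, u) = Dφ(φ^t(u)) Φ(t, u)`. -/
def fundamental (φ : Plane → Plane) : ℕ → Plane → (Plane →L[ℝ] Plane)
  | 0, _ => ContinuousLinearMap.id ℝ Plane
  | t + 1, u => (fderiv ℝ φ (φ^[t] u)).comp (fundamental φ t u)

/-- The finite-time Lyapunov exponents `(1/t) ln σ_i(t, u)`, meant for `t > 0`. -/
def lyapunovExponent (φ : Plane → Plane) (t : ℕ) (u : Plane) (i : ℕ) : ℝ :=
  (1 / (t : ℝ)) * Real.log (sing (fundamental φ t u) i)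

/-- `max {m ≤ n : l 0 + ⋯ + l (m - 1) ≥ 0}`; the empty sum `m = 0` always qualifies. -/
def kaplanYorkeIndex (n : ℕ) (l : ℕ → ℝ) : ℕ :=
  Nat.findGreatest (fun m => 0 ≤ ∑ i ∈ Finset.range m, l i) n

/-- The Kaplan–Yorke dimension of `l 0 ≥ ⋯ ≥ l (n - 1)`. -/
def kaplanYorke (n : ℕ) (l : ℕ → ℝ) : ℝ :=
  if kaplanYorkeIndex n l = n then (n : ℝ)
  else (kaplanYorkeIndex n l : ℝ) +
    (∑ i ∈ Finset.range (kaplanYorkeIndex n l), l i) / |l (kaplanYorkeIndex n l)|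

/-- The finite-time local Lyapunov dimension `dim_L(t, u)`. -/
def localLyapunovDim (φ : Plane → Plane) (t : ℕ) (u : Plane) : ℝ :=
  kaplanYorke 2 (lyapunovExponent φ t u)

/-- The finite-time Lyapunov dimension `dim_L(t, K) = sup_{u ∈ K} dim_L(t, u)`. The local
dimensions are nonnegative, so passing to `[0, ∞]` loses nothing. -/
def finiteTimeLyapunovDim (φ : Plane → Plane) (t : ℕ) (K : Set Plane) : ENNReal :=
  ⨆ u ∈ K, ENNReal.ofReal (localLyapunovDim φ t u)

/-- The Lyapunov dimension `dim_L K = liminf_{t → ∞} sup_{u ∈ K} dim_L(t, u)`. -/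
def lyapunovDim (φ : Plane → Plane) (K : Set Plane) : ENNReal :=
  liminf (fun t : ℕ => finiteTimeLyapunovDim φ t K) atTop

/-- `K` is a nonempty closed bounded set with `φ^t(K) = K` for all `t ≥ 0`. -/
structure IsBoundedInvariant (φ : Plane → Plane) (K : Set Plane) : Prop where
  nonempty : K.Nonempty
  isClosed : IsClosed K
  isBounded : Bornology.IsBounded K
  image_iterate : ∀ t : ℕ, φ^[t] '' K = K

/-- `m = a (1 + 2b) / (1 - b)`. -/
def feitM (a b : ℝ) : ℝ := a * (1 + 2 * b) / (1 - b)

/-- `r = -(1 + √(1 + 4a)) / 2`. -/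
def feitR (a : ℝ) : ℝ := -((1 + √(1 + 4 * a)) / 2)

/-- Feit's localization region `closure M \ (Q ∪ R₁ ∪ R₂)`. -/
def feitRegion (a b : ℝ) : Set Plane :=
  closure {u : Plane | u 0 < feitM a b ∧ u 1 < feitM a b + a} \
    ({u : Plane | u 0 < feitR a ∧ u 1 < 0} ∪
      {u : Plane | u 0 < -√(b * (feitM a b + a) + a - feitR a) ∧ u 1 ≤ feitM a b + a} ∪
      {u : Plane | u 0 ≤ feitM a b ∧
        u 1 < -((1 / b) * (a + √(a + b * feitM a b - feitR a)))})

/-- `σ₁(x) = ½ (√(4x² + (1 + |b|)²) + √(4x² + (1 - |b|)²))`. -/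
def sigmaOne (b x : ℝ) : ℝ :=
  (1 / 2) * (√(4 * x ^ 2 + (1 + |b|) ^ 2) + √(4 * x ^ 2 + (1 - |b|) ^ 2))

/-- `max {-r, m, √(b (m + a) + a - r)}`. -/
def feitRadius (a b : ℝ) : ℝ :=
  max (-feitR a) (max (feitM a b) (√(b * (feitM a b + a) + a - feitR a)))

end Henon

end

/-! The Jacobian determinant of the Hénon map is the constant -b. So the two singular values of Dφ
have product |b|, and the Frobenius norm gives the sum of their squares; this yields the closed
formula. It also makes λ₁ + λ₂ = ln b at every time, so for 0 < b < 1 the local dimension is a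
function of λ₁ alone: 1 + λ₁ / (λ₁ - ln b) if λ₁ ≥ 0, and 0 otherwise (`localLyapunovDim_henonMap`).

The inequality between the dimensions is a Douady–Oesterlé argument. If the Lyapunov dimension is
below c < dimH K, a single time t bounds all local dimensions by c. For c ≤ 1 this forces φ^t to
contract infinitesimally on K, so K has dimension 0. For c > 1 it bounds ‖Dφ^t‖ by some L, with
determinant of modulus D. A small piece of K of diameter r then has an image covered by about L² / D
sets of diameter about r D / L (`exists_cover_image_of_approximatesLinearOn`). Replacing t by a
large multiple makes the numerical constants harmless, and iterating the cover over K = F(K) kills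
the Hausdorff measure in every dimension d > c.

The upper bound on the Lyapunov dimension needs only a bound |x| ≤ X on K: by submultiplicativity λ₁
≤ ln σ₁(X) at all times, and λ / (λ - ln b) increases with λ (`lyapunovDim_henonMap_le`). Feit's
region gives X = `feitRadius` directly. For the classical parameters invariance improves this to X =
1.89: first x ≤ 1.83, by following an extremal point backwards, and then x ≥ -1.89, since a point
further left would enter the excluded set Q after two steps. -/

namespace Henon

open Module InnerProductSpace MeasureTheory
open scoped RealInnerProductSpace Topology ENNReal NNReal

/-! ### Singular values of a map of the plane -/

section SingularValues

theorem sing_nonneg (A : Plane →L[ℝ] Plane) (i : ℕ) : 0 ≤ sing A i :=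
  LinearMap.singularValues_nonneg _ i

theorem sing_one_le_sing_zero (A : Plane →L[ℝ] Plane) : sing A 1 ≤ sing A 0 :=
  LinearMap.singularValues_antitone _ zero_le_one

theorem finrank_plane : finrank ℝ Plane = 2 := finrank_euclideanSpace_fin

/-- The product of the two singular values is the modulus of the determinant. -/
theorem sing_zero_mul_sing_one (A : Plane →L[ℝ] Plane) :
    sing A 0 * sing A 1 = |(A : Plane →ₗ[ℝ] Plane).det| := by
  have h := (A : Plane →ₗ[ℝ] Plane).normDet_eq_prod_singularValues
  rw [finrank_plane, Finset.prod_range_succ, Finset.prod_range_one,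
    LinearMap.normDet_eq_norm_det] at h
  exact h.symm

/-- The right singular vectors of a map of the plane. -/
theorem exists_singular_basis (A : Plane →L[ℝ] Plane) :
    ∃ e : OrthonormalBasis (Fin 2) ℝ Plane,
      (∀ i, ‖A (e i)‖ = sing A i) ∧ ⟪A (e 0), A (e 1)⟫ = 0 := by
  set T : Plane →ₗ[ℝ] Plane := A.toLinearMap
  have hs := T.isSymmetric_adjoint_comp_self
  have key : ∀ i j, ⟪A (hs.eigenvectorBasis finrank_plane i),
      A (hs.eigenvectorBasis finrank_plane j)⟫ =
      sing A j ^ 2 * ⟪hs.eigenvectorBasis finrank_plane i,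
        hs.eigenvectorBasis finrank_plane j⟫ := by
    intro i j
    have h := hs.apply_eigenvectorBasis finrank_plane j
    rw [← T.sq_singularValues_fin finrank_plane] at h
    change ⟪T _, T _⟫ = T.singularValues j ^ 2 * _
    rw [← LinearMap.adjoint_inner_right, ← LinearMap.comp_apply, h, inner_smul_right]
    rfl
  refine ⟨hs.eigenvectorBasis finrank_plane, fun i => ?_, ?_⟩
  · have h := key i i
    rw [real_inner_self_eq_norm_sq, real_inner_self_eq_norm_sq,
      (hs.eigenvectorBasis finrank_plane).norm_eq_one] at h
    rw [one_pow, mul_one] at h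
    exact (sq_eq_sq₀ (norm_nonneg _) (sing_nonneg A i)).1 h
  · rw [key, (hs.eigenvectorBasis finrank_plane).inner_eq_zero (by decide), mul_zero]

/-- The sum of the squared singular values is the squared Frobenius norm. -/
theorem sing_sq_add_sing_sq (A : Plane →L[ℝ] Plane) (b : OrthonormalBasis (Fin 2) ℝ Plane) :
    sing A 0 ^ 2 + sing A 1 ^ 2 = ‖A (b 0)‖ ^ 2 + ‖A (b 1)‖ ^ 2 := by
  obtain ⟨e, he, -⟩ := exists_singular_basis A
  set T : Plane →ₗ[ℝ] Plane := A.toLinearMap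
  have h : ∀ c : OrthonormalBasis (Fin 2) ℝ Plane,
      LinearMap.trace ℝ Plane (LinearMap.adjoint T ∘ₗ T) = ‖A (c 0)‖ ^ 2 + ‖A (c 1)‖ ^ 2 := by
    intro c
    rw [LinearMap.trace_eq_sum_inner _ c, Fin.sum_univ_two]
    simp only [LinearMap.comp_apply, LinearMap.adjoint_inner_right, real_inner_self_eq_norm_sq]
    rfl
  have h0 := he 0
  have h1 := he 1
  rw [← h b, h e, h0, h1]
  rfl

/-- The largest singular value is the operator norm. -/
theorem sing_zero_eq_norm (A : Plane →L[ℝ] Plane) : sing A 0 = ‖A‖ := by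
  obtain ⟨e, he, horth⟩ := exists_singular_basis A
  apply le_antisymm
  · have h := A.le_opNorm (e 0)
    rwa [he 0, e.norm_eq_one, mul_one] at h
  · refine A.opNorm_le_bound (sing_nonneg A 0) fun v => ?_
    have hv : v = ⟪e 0, v⟫ • e 0 + ⟪e 1, v⟫ • e 1 := by
      conv_lhs => rw [← e.sum_repr' v, Fin.sum_univ_two]
    have hn : ‖v‖ ^ 2 = ⟪e 0, v⟫ ^ 2 + ⟪e 1, v⟫ ^ 2 := by
      have := e.sum_sq_norm_inner_right v
      rw [Fin.sum_univ_two] at this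
      simpa using this.symm
    have hA : ‖A v‖ ^ 2 = (⟪e 0, v⟫ * sing A 0) ^ 2 + (⟪e 1, v⟫ * sing A 1) ^ 2 := by
      conv_lhs => rw [hv]
      rw [map_add, map_smul, map_smul, norm_add_sq_real, inner_smul_left, inner_smul_right, horth,
        norm_smul, norm_smul, he 0, he 1]
      simp [mul_pow]
    have h01 := sing_one_le_sing_zero A
    have h1 := sing_nonneg A 1
    have h0 := sing_nonneg A 0
    refine (sq_le_sq₀ (norm_nonneg _) (by positivity)).1 ?_
    rw [hA, mul_pow, mul_pow, mul_pow, hn, mul_add]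
    have : sing A 1 ^ 2 ≤ sing A 0 ^ 2 := by gcongr
    nlinarith [sq_nonneg ⟪e 1, v⟫]

end SingularValues

/-! ### The Jacobian of the Hénon map and its singular values -/

section Derivative

/-- The derivative of the Hénon map at `u`. -/
noncomputable def henonDeriv (b : ℝ) (u : Plane) : Plane →L[ℝ] Plane :=
  (Matrix.toEuclideanCLM (𝕜 := ℝ)) !![-(2 * u 0), b; 1, 0]

theorem henonDeriv_apply (b : ℝ) (u v : Plane) :
    henonDeriv b u v = !₂[-(2 * u 0) * v 0 + b * v 1, v 0] := by
  ext i
  fin_cases i <;>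
    simp [henonDeriv, Matrix.ofLp_toEuclideanCLM, Matrix.mulVec, dotProduct, Fin.sum_univ_two]

theorem hasFDerivAt_henonMap (a b : ℝ) (u : Plane) :
    HasFDerivAt (henonMap a b) (henonDeriv b u) u := by
  refine HasStrictFDerivAt.hasFDerivAt (hasStrictFDerivAt_euclidean.2 ?_)
  have h : ∀ i : Fin 2, HasStrictFDerivAt (fun v : Plane => v i)
      (EuclideanSpace.proj i : Plane →L[ℝ] ℝ) u := fun i =>
    (EuclideanSpace.proj i : Plane →L[ℝ] ℝ).hasStrictFDerivAt
  intro i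
  fin_cases i
  · have := (((h 1).const_mul b).const_add a).sub ((h 0).pow 2)
    refine this.congr_fderiv ?_
    ext v
    simp [henonDeriv_apply]
    ring
  · refine (h 0).congr_fderiv ?_
    ext v
    simp [henonDeriv_apply]

theorem fderiv_henonMap (a b : ℝ) (u : Plane) :
    fderiv ℝ (henonMap a b) u = henonDeriv b u :=
  (hasFDerivAt_henonMap a b u).fderiv

theorem contDiff_henonMap (a b : ℝ) : ContDiff ℝ 1 (henonMap a b) := by
  rw [contDiff_euclidean]
  intro i
  have h : ∀ i : Fin 2, ContDiff ℝ 1 (fun v : Plane => v i) := fun i =>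
    (EuclideanSpace.proj i : Plane →L[ℝ] ℝ).contDiff
  fin_cases i
  · exact (contDiff_const.add (contDiff_const.mul (h 1))).sub ((h 0).pow 2)
  · exact h 0

theorem det_henonDeriv (b : ℝ) (u : Plane) :
    (henonDeriv b u : Plane →ₗ[ℝ] Plane).det = -b := by
  have : (henonDeriv b u : Plane →ₗ[ℝ] Plane) =
      Matrix.toLin (EuclideanSpace.basisFun (Fin 2) ℝ).toBasis
        (EuclideanSpace.basisFun (Fin 2) ℝ).toBasis !![-(2 * u 0), b; 1, 0] := by
    rfl
  rw [this, LinearMap.det_toLin, Matrix.det_fin_two_of]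
  ring

theorem one_le_sigmaOne (b x : ℝ) : 1 ≤ sigmaOne b x := by
  have h1 : 1 + |b| ≤ √(4 * x ^ 2 + (1 + |b|) ^ 2) :=
    Real.le_sqrt_of_sq_le (by nlinarith [sq_nonneg x])
  have h2 : 1 - |b| ≤ √(4 * x ^ 2 + (1 - |b|) ^ 2) :=
    Real.le_sqrt_of_sq_le (by nlinarith [sq_nonneg x])
  unfold sigmaOne
  linarith

/-- With p ≥ q the singular values, p² + q² = 4x² + 1 + b² and p q = |b|. Hence the two radicands in
`sigmaOne` are (p + q)² and (p - q)², and half the sum of their roots is p. -/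
theorem sing_henonDeriv (b : ℝ) (u : Plane) :
    sing (henonDeriv b u) 0 = sigmaOne b (u 0) ∧
      sing (henonDeriv b u) 0 * sing (henonDeriv b u) 1 = |b| := by
  have hd := sing_zero_mul_sing_one (henonDeriv b u)
  rw [det_henonDeriv, abs_neg] at hd
  have hs := sing_sq_add_sing_sq (henonDeriv b u) (EuclideanSpace.basisFun (Fin 2) ℝ)
  have hf : sing (henonDeriv b u) 0 ^ 2 + sing (henonDeriv b u) 1 ^ 2 =
      4 * u 0 ^ 2 + 1 + |b| ^ 2 := by
    rw [hs]
    simp [EuclideanSpace.norm_sq_eq, Fin.sum_univ_two, henonDeriv_apply]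
    ring
  refine ⟨?_, hd⟩
  have h1 := sing_nonneg (henonDeriv b u) 1
  have h01 := sing_one_le_sing_zero (henonDeriv b u)
  set p := sing (henonDeriv b u) 0
  set q := sing (henonDeriv b u) 1
  have e1 : 4 * u 0 ^ 2 + (1 + |b|) ^ 2 = (p + q) ^ 2 := by rw [← hd] at hf ⊢; linarith
  have e2 : 4 * u 0 ^ 2 + (1 - |b|) ^ 2 = (p - q) ^ 2 := by rw [← hd] at hf ⊢; linarith
  rw [sigmaOne, e1, e2, Real.sqrt_sq (by linarith), Real.sqrt_sq (by linarith)]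
  ring

theorem henon_singular_values (a b : ℝ) (u : Plane) :
    sing (fderiv ℝ (henonMap a b) u) 0 = sigmaOne b (u 0) ∧
      sing (fderiv ℝ (henonMap a b) u) 1 = |b| / sigmaOne b (u 0) ∧
      1 ≤ sigmaOne b (u 0) ∧ |b| / sigmaOne b (u 0) ≤ |b| := by
  obtain ⟨h0, h1⟩ := sing_henonDeriv b u
  have hs := one_le_sigmaOne b (u 0)
  rw [fderiv_henonMap]
  refine ⟨h0, ?_, hs, div_le_self (abs_nonneg b) hs⟩
  rw [h0] at h1
  rw [eq_div_iff (by positivity), mul_comm, h1]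

theorem sigmaOne_le_sigmaOne {b x y : ℝ} (h : |x| ≤ |y|) : sigmaOne b x ≤ sigmaOne b y := by
  have := sq_le_sq.2 h
  unfold sigmaOne
  gcongr

end Derivative

/-! ### The derivative cocycle along orbits -/

section Cocycle

theorem fundamental_eq_fderiv_iterate {φ : Plane → Plane} (hφ : Differentiable ℝ φ) (t : ℕ)
    (u : Plane) : fundamental φ t u = fderiv ℝ φ^[t] u := by
  induction t with
  | zero => exact fderiv_id.symm
  | succ t ih =>
    rw [Function.iterate_succ', fderiv_comp _ (hφ _) ((hφ.iterate t) _), fundamental, ih]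

theorem norm_fundamental_add_le (φ : Plane → Plane) (hφ : Differentiable ℝ φ) (s t : ℕ)
    (u : Plane) :
    ‖fundamental φ (s + t) u‖ ≤ ‖fundamental φ s (φ^[t] u)‖ * ‖fundamental φ t u‖ := by
  rw [fundamental_eq_fderiv_iterate hφ, fundamental_eq_fderiv_iterate hφ,
    fundamental_eq_fderiv_iterate hφ, Function.iterate_add,
    fderiv_comp _ ((hφ.iterate s) _) ((hφ.iterate t) _)]
  exact ContinuousLinearMap.opNorm_comp_le _ _

/-- Submultiplicativity along an orbit that stays in K. It serves with t = 1 to bound the exponents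
at all times, and with general t to pass from one good time to its multiples. -/
theorem norm_fundamental_mul_le {φ : Plane → Plane} (hφ : Differentiable ℝ φ) {K : Set Plane}
    (hK : Set.MapsTo φ K K) {t : ℕ} {L : ℝ} (hL : ∀ u ∈ K, ‖fundamental φ t u‖ ≤ L) (k : ℕ) :
    ∀ u ∈ K, ‖fundamental φ (k * t) u‖ ≤ L ^ k := by
  induction k with
  | zero => intro u _; simp [fundamental]
  | succ k ih =>
    intro u hu
    have h0 : 0 ≤ L := (norm_nonneg _).trans (hL u hu)
    rw [Nat.succ_mul, pow_succ]
    refine (norm_fundamental_add_le φ hφ _ _ u).trans ?_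
    gcongr
    · exact ih _ (hK.iterate t hu)
    · exact hL u hu

theorem abs_det_fundamental_henonMap (a b : ℝ) (t : ℕ) (u : Plane) :
    |(fundamental (henonMap a b) t u : Plane →ₗ[ℝ] Plane).det| = |b| ^ t := by
  induction t with
  | zero => simp [fundamental]
  | succ t ih =>
    rw [fundamental, fderiv_henonMap, ContinuousLinearMap.toLinearMap_comp, LinearMap.det_comp,
      det_henonDeriv, abs_mul, ih, abs_neg, pow_succ']

end Cocycle

/-! ### Coverings and Hausdorff dimension -/

section Covering

/-- If a map with `K ⊆ F(K)` sends every small piece of `K` of diameter at most `r` into a union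
of at most `N` sets of diameter at most `ρ r`, and `N ρ ^ d < 1`, then `dimH K ≤ d`. -/
theorem dimH_le_of_image_cover {X : Type*} [MetricSpace X] {K : Set X} (hK : IsCompact K)
    {F : X → X} (hF : K ⊆ F '' K) {d : ℝ≥0} {N ρ δ : ℝ} (hδ : 0 < δ)
    (hρ0 : 0 < ρ) (hρ : ρ < 1) (hN : N * ρ ^ (d : ℝ) < 1)
    (h : ∀ E ⊆ K, ∀ r, 0 < r → r ≤ δ → (∀ v ∈ E, ∀ w ∈ E, dist v w ≤ r) →
      ∃ (ι : Type) (_ : Fintype ι) (S : ι → Set X), (Fintype.card ι : ℝ) ≤ N ∧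
        F '' E ⊆ ⋃ i, S i ∧ ∀ i, ∀ v ∈ S i, ∀ w ∈ S i, dist v w ≤ ρ * r) :
    dimH K ≤ d := by
  borelize X
  have hN0 : 0 ≤ N := by
    obtain ⟨ι, _, S, hc, -⟩ := h ∅ (Set.empty_subset K) δ hδ le_rfl (by simp)
    exact (Nat.cast_nonneg _).trans hc
  -- Iterating the hypothesis n times: since K ⊆ F(K), the images of a cover of K cover K again.
  -- Each new set is cut down to K so that the hypothesis applies to it at the next step.
  obtain ⟨m, hm⟩ : ∃ m : ℝ, ∀ n : ℕ, ∃ (ι : Type) (_ : Fintype ι) (S : ι → Set X),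
      (Fintype.card ι : ℝ) ≤ m * N ^ n ∧ K ⊆ ⋃ i, S i ∧ (∀ i, S i ⊆ K) ∧
        ∀ i, ∀ v ∈ S i, ∀ w ∈ S i, dist v w ≤ δ * ρ ^ n := by
    obtain ⟨s, hsK, hsf, hs⟩ := hK.finite_cover_balls (half_pos hδ)
    have := hsf.fintype
    obtain ⟨k, ⟨g⟩⟩ := Finite.exists_equiv_fin s
    refine ⟨k, fun n => ?_⟩
    induction n with
    | zero =>
      refine ⟨Fin k, inferInstance, fun i => Metric.ball (g.symm i : X) (δ / 2) ∩ K, by simp,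
        fun x hx => ?_, fun i => Set.inter_subset_right, ?_⟩
      · obtain ⟨y, hy, hxy⟩ := Set.mem_iUnion₂.1 (hs hx)
        exact Set.mem_iUnion.2 ⟨g ⟨y, hy⟩, by simpa using hxy, hx⟩
      · rintro i v ⟨hv, -⟩ w ⟨hw, -⟩
        have h1 := Metric.mem_ball.1 hv
        have h2 := Metric.mem_ball.1 hw
        have h3 := dist_triangle_right v w (g.symm i : X)
        simp only [pow_zero, mul_one]
        linarith
    | succ n ih =>
      obtain ⟨ι, _, S, hc, hcov, hsub, hdiam⟩ := ih
      have hr : 0 < δ * ρ ^ n := by positivity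
      have hr' : δ * ρ ^ n ≤ δ := mul_le_of_le_one_right hδ.le (pow_le_one₀ hρ0.le hρ.le)
      choose κ hκ T hT hTcov hTdiam using fun i => h (S i) (hsub i) _ hr hr' (hdiam i)
      refine ⟨Σ i, κ i, inferInstance, fun p => T p.1 p.2 ∩ K, ?_, fun x hx => ?_,
        fun p => Set.inter_subset_right, ?_⟩
      · rw [Fintype.card_sigma, Nat.cast_sum]
        calc ∑ i, (Fintype.card (κ i) : ℝ) ≤ ∑ _i : ι, N := Finset.sum_le_sum fun i _ => hT i
          _ = Fintype.card ι * N := by rw [Finset.sum_const, nsmul_eq_mul, Finset.card_univ]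
          _ ≤ k * N ^ n * N := by gcongr
          _ = k * N ^ (n + 1) := by ring
      · obtain ⟨y, hy, rfl⟩ := hF hx
        obtain ⟨i, hi⟩ := Set.mem_iUnion.1 (hcov hy)
        obtain ⟨j, hj⟩ := Set.mem_iUnion.1 (hTcov i (Set.mem_image_of_mem F hi))
        exact Set.mem_iUnion.2 ⟨⟨i, j⟩, hj, hx⟩
      · rintro p v ⟨hv, -⟩ w ⟨hw, -⟩
        refine (hTdiam p.1 p.2 v hv w hw).trans_eq ?_
        ring
  choose ι hι S hc hcov _ hdiam using hm
  have hm0 : 0 ≤ m := by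
    have := (Nat.cast_nonneg _).trans (hc 0)
    simpa using this
  have hed : ∀ n i, Metric.ediam (S n i) ≤ ENNReal.ofReal (δ * ρ ^ n) := fun n i =>
    Metric.ediam_le fun v hv w hw => by
      rw [edist_dist]
      exact ENNReal.ofReal_le_ofReal (hdiam n i v hv w hw)
  have hlim : Tendsto (fun n : ℕ => ENNReal.ofReal (δ * ρ ^ n)) atTop (𝓝 0) := by
    have := (tendsto_pow_atTop_nhds_zero_of_lt_one hρ0.le hρ).const_mul δ
    rw [mul_zero] at this
    simpa using ENNReal.tendsto_ofReal this
  -- The d-sum of the n-th cover decays like (N ρ^d)^n, so the d-dimensional Hausdorff measure of K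
  -- vanishes.
  have hsum : ∀ n, ∑ i, Metric.ediam (S n i) ^ (d : ℝ) ≤
      ENNReal.ofReal (m * δ ^ (d : ℝ) * (N * ρ ^ (d : ℝ)) ^ n) := by
    intro n
    have hp : 0 < δ * ρ ^ n := by positivity
    calc ∑ i, Metric.ediam (S n i) ^ (d : ℝ)
        ≤ ∑ _i : ι n, ENNReal.ofReal ((δ * ρ ^ n) ^ (d : ℝ)) := by
          refine Finset.sum_le_sum fun i _ => ?_
          rw [← ENNReal.ofReal_rpow_of_pos hp]
          exact ENNReal.rpow_le_rpow (hed n i) d.coe_nonneg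
      _ = ENNReal.ofReal (Fintype.card (ι n) * (δ * ρ ^ n) ^ (d : ℝ)) := by
          rw [Finset.sum_const, Finset.card_univ, nsmul_eq_mul,
            ENNReal.ofReal_mul (Nat.cast_nonneg _), ENNReal.ofReal_natCast]
      _ ≤ ENNReal.ofReal (m * N ^ n * (δ * ρ ^ n) ^ (d : ℝ)) := by
          gcongr
          exact hc n
      _ = _ := by
          congr 1
          rw [Real.mul_rpow hδ.le (by positivity), mul_pow, ← Real.rpow_natCast (ρ ^ (d : ℝ)),
            ← Real.rpow_natCast ρ, ← Real.rpow_mul hρ0.le, ← Real.rpow_mul hρ0.le,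
            mul_comm (n : ℝ)]
          ring
  have hlim' : Tendsto (fun n : ℕ => ENNReal.ofReal (m * δ ^ (d : ℝ) * (N * ρ ^ (d : ℝ)) ^ n))
      atTop (𝓝 0) := by
    have := (tendsto_pow_atTop_nhds_zero_of_lt_one (by positivity) hN).const_mul
      (m * δ ^ (d : ℝ))
    rw [mul_zero] at this
    simpa using ENNReal.tendsto_ofReal this
  have hμ : Measure.hausdorffMeasure (d : ℝ) K ≤ 0 := by
    refine (Measure.hausdorffMeasure_le_liminf_sum (d : ℝ) K _ hlim S
      (Eventually.of_forall hed) (Eventually.of_forall hcov)).trans ?_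
    rw [← hlim'.liminf_eq]
    exact liminf_le_liminf (Eventually.of_forall hsum)
  exact dimH_le_of_hausdorffMeasure_ne_top (hμ.trans_lt ENNReal.zero_lt_top).ne

/-- On a compact set a `C¹` map is uniformly close to its differentials on small pieces. -/
theorem exists_approximatesLinearOn_of_isCompact {V : Type*} [NormedAddCommGroup V]
    [NormedSpace ℝ V] {K : Set V} (hK : IsCompact K) {F : V → V} (hF : ContDiff ℝ 1 F) {c : ℝ≥0}
    (hc : 0 < c) :
    ∃ δ > 0, ∀ E ⊆ K, E.Nonempty → (∀ v ∈ E, ∀ w ∈ E, dist v w ≤ δ) →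
      ∃ u ∈ K, ApproximatesLinearOn F (fderiv ℝ F u) E c := by
  -- Strict differentiability compares F v - F w with the differential at u for all pairs v, w near
  -- u, so K need not be convex. A Lebesgue number then makes the scale uniform.
  choose s hs happ using fun u : V =>
    (hF.contDiffAt.hasStrictFDerivAt (x := u) one_ne_zero).approximates_deriv_on_nhds
      (Or.inr hc)
  obtain ⟨δ, hδ, hball⟩ := lebesgue_number_lemma_of_metric hK
    (c := fun u : K => interior (s u)) (fun _ => isOpen_interior)
    (fun u hu => Set.mem_iUnion.2 ⟨⟨u, hu⟩, mem_interior_iff_mem_nhds.2 (hs u)⟩)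
  refine ⟨δ / 2, half_pos hδ, fun E hE ⟨v, hv⟩ hd => ?_⟩
  obtain ⟨u, hu⟩ := hball v (hE hv)
  refine ⟨u, u.2, (happ u).mono_set fun w hw => interior_subset (hu ?_)⟩
  exact Metric.mem_ball.2 ((hd w hw v hv).trans_lt (half_lt_self hδ))

/-- The image of a planar set of diameter `r` under a map that is nearly linear with linear part
`A` is covered by `16 L² / |det A|` sets of diameter `3 r |det A| / L`, for any `L ≥ ‖A‖`. -/
theorem exists_cover_image_of_approximatesLinearOn {F : Plane → Plane} {A : Plane →L[ℝ] Plane}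
    {E : Set Plane} {c : ℝ≥0} (hF : ApproximatesLinearOn F A E c) {r L D : ℝ} (hr : 0 < r)
    (hE : ∀ v ∈ E, ∀ w ∈ E, dist v w ≤ r) (hne : E.Nonempty) (hD : 0 < D)
    (hdet : |(A : Plane →ₗ[ℝ] Plane).det| = D) (hL : ‖A‖ ≤ L) (hc : (c : ℝ) ≤ D / L) :
    ∃ (ι : Type) (_ : Fintype ι) (S : ι → Set Plane),
      (Fintype.card ι : ℝ) ≤ 16 * L ^ 2 / D ∧ F '' E ⊆ ⋃ i, S i ∧
        ∀ i, ∀ v ∈ S i, ∀ w ∈ S i, dist v w ≤ 3 * (D / L) * r := by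
  obtain ⟨e, he, -⟩ := exists_singular_basis A
  have he0 := he 0
  have he1 := he 1
  simp only [Fin.val_zero, Fin.val_one] at he0 he1
  have hprod := sing_zero_mul_sing_one A
  rw [hdet] at hprod
  have hle := sing_one_le_sing_zero A
  have hn1 := sing_nonneg A 1
  rw [← sing_zero_eq_norm] at hL
  set p := sing A 0
  set q := sing A 1
  have hp : 0 < p := by
    rcases (hn1.trans hle).eq_or_lt with h | h
    · rw [← h, zero_mul] at hprod; exact absurd hprod hD.ne
    · exact h
  have hL0 : 0 < L := hp.trans_le hL
  -- The scale η depends only on D and L, hence is common to all pieces of K. Since p q = D and p ≤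
  -- L, it is at most q, so both axes of the image ellipse are at least η.
  set η := D / L with hη
  have hη0 : 0 < η := by positivity
  have hηq : η ≤ q := by
    rw [hη, div_le_iff₀ hL0, ← hprod, mul_comm]
    gcongr
  have hq : 0 < q := hη0.trans_le hηq
  obtain ⟨u, hu⟩ := hne
  have hrange : ∀ {x : ℝ}, 0 < x → ∀ i, ∀ v ∈ E,
      ⌊⟪e i, v - u⟫ / r * x⌋ ∈ Finset.Icc ⌊-x⌋ ⌊x⌋ := by
    intro x hx i v hv
    have h1 : |⟪e i, v - u⟫ / r| ≤ 1 := by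
      rw [abs_div, abs_of_pos hr, div_le_one hr]
      refine (abs_real_inner_le_norm _ _).trans ?_
      rw [e.norm_eq_one, one_mul, ← dist_eq_norm]
      exact hE v hv u hu
    obtain ⟨h2, h3⟩ := abs_le.1 h1
    rw [Finset.mem_Icc]
    constructor <;> apply Int.floor_le_floor <;> nlinarith
  -- The count is at most 2 x + 2, which is where x ≥ 1 is used.
  have hcard : ∀ {x : ℝ}, 1 ≤ x → ((Finset.Icc ⌊-x⌋ ⌊x⌋).card : ℝ) ≤ 4 * x := by
    intro x hx
    have h1 : ⌊-x⌋ ≤ ⌊x⌋ + 1 := (Int.floor_le_floor (by linarith)).trans (by simp)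
    have h2 : ((Finset.Icc ⌊-x⌋ ⌊x⌋).card : ℤ) = ⌊x⌋ + 1 - ⌊-x⌋ := Int.card_Icc_of_le _ _ h1
    have h3 : ((Finset.Icc ⌊-x⌋ ⌊x⌋).card : ℝ) = ⌊x⌋ + 1 - ⌊-x⌋ := by exact_mod_cast h2
    rw [h3]
    linarith [Int.floor_le x, Int.lt_floor_add_one (-x)]
  have hclose : ∀ {x : ℝ} {v w : Plane} {i : Fin 2}, 0 < x →
      ⌊⟪e i, v - u⟫ / r * (x / η)⌋ = ⌊⟪e i, w - u⟫ / r * (x / η)⌋ →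
      |⟪e i, v - w⟫| * x ≤ η * r := by
    intro x v w i hx h
    have h1 := (Int.abs_sub_lt_one_of_floor_eq_floor h).le
    have h2 : ⟪e i, v - u⟫ / r * (x / η) - ⟪e i, w - u⟫ / r * (x / η) =
        ⟪e i, v - w⟫ * x / (η * r) := by
      rw [← sub_sub_sub_cancel_right v w u, inner_sub_right (e i) (v - u)]
      field_simp
    rw [h2, abs_div, abs_mul, abs_of_pos hx, abs_of_pos (by positivity : 0 < η * r),
      div_le_one (by positivity)] at h1
    exact h1
  -- Grid in the right singular directions with cells of sides η r / p and η r / q. `A` stretches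
  -- these sides by p and q, so both become η r. The number of cells is at most 16 (p / η) (q / η) =
  -- 16 D / η² = 16 L² / D.
  refine ⟨↥(Finset.Icc ⌊-(p / η)⌋ ⌊p / η⌋ ×ˢ Finset.Icc ⌊-(q / η)⌋ ⌊q / η⌋), inferInstance,
    fun z => F '' {v ∈ E | ⌊⟪e 0, v - u⟫ / r * (p / η)⌋ = z.1.1 ∧
      ⌊⟪e 1, v - u⟫ / r * (q / η)⌋ = z.1.2}, ?_, ?_, ?_⟩
  · rw [Fintype.card_coe, Finset.card_product, Nat.cast_mul]
    have h1 := hcard ((one_le_div hη0).2 (hηq.trans hle))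
    have h2 := hcard ((one_le_div hη0).2 hηq)
    calc _ ≤ 4 * (p / η) * (4 * (q / η)) := by gcongr
      _ = 16 * (p * q) / η ^ 2 := by field_simp; ring
      _ = 16 * L ^ 2 / D := by rw [hprod, hη]; field_simp
  · rintro _ ⟨v, hv, rfl⟩
    refine Set.mem_iUnion.2 ⟨⟨(_, _), Finset.mk_mem_product
      (hrange (by positivity : 0 < p / η) 0 v hv) (hrange (by positivity : 0 < q / η) 1 v hv)⟩,
      v, ⟨hv, rfl, rfl⟩, rfl⟩
  · rintro z _ ⟨v, ⟨hv, hv0, hv1⟩, rfl⟩ _ ⟨w, ⟨hw, hw0, hw1⟩, rfl⟩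
    have h0 := hclose hp (hv0.trans hw0.symm)
    have h1 := hclose hq (hv1.trans hw1.symm)
    have hlin : ‖A (v - w)‖ ≤ 2 * (η * r) := by
      have hexp : A (v - w) = ⟪e 0, v - w⟫ • A (e 0) + ⟪e 1, v - w⟫ • A (e 1) := by
        conv_lhs => rw [← e.sum_repr' (v - w), Fin.sum_univ_two, map_add, map_smul, map_smul]
      rw [hexp]
      refine (norm_add_le _ _).trans ?_
      rw [norm_smul, norm_smul, he0, he1, Real.norm_eq_abs, Real.norm_eq_abs]
      linarith
    have h2 := hF v hv w hw
    have h3 : (c : ℝ) * ‖v - w‖ ≤ η * r := by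
      rw [← dist_eq_norm]
      gcongr
      exact hE v hv w hw
    rw [dist_eq_norm]
    -- The factor 3: one η r from the nonlinear error, one from each singular direction.
    calc ‖F v - F w‖ = ‖(F v - F w - A (v - w)) + A (v - w)‖ := by rw [sub_add_cancel]
      _ ≤ ‖F v - F w - A (v - w)‖ + ‖A (v - w)‖ := norm_add_le _ _
      _ ≤ η * r + 2 * (η * r) := add_le_add (h2.trans h3) hlin
      _ = 3 * η * r := by ring

/-- A Douady–Oesterlé type estimate: planar maps with constant Jacobian. -/
theorem dimH_le_of_abs_det_fderiv_eq {K : Set Plane} (hK : IsCompact K) {F : Plane → Plane}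
    (hF : ContDiff ℝ 1 F) (hKF : K ⊆ F '' K) {L D : ℝ} (hL0 : 0 < L) (hD : 0 < D)
    (hL : ∀ u ∈ K, ‖fderiv ℝ F u‖ ≤ L)
    (hdet : ∀ u ∈ K, |(fderiv ℝ F u : Plane →ₗ[ℝ] Plane).det| = D) (hDL : 3 * (D / L) < 1)
    {d : ℝ≥0} (hLd : 16 * L ^ 2 / D * (3 * (D / L)) ^ (d : ℝ) < 1) :
    dimH K ≤ d := by
  have hη : 0 < D / L := by positivity
  obtain ⟨δ, hδ, happ⟩ := exists_approximatesLinearOn_of_isCompact hK hF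
    (c := ⟨D / L, hη.le⟩) hη
  refine dimH_le_of_image_cover hK hKF hδ (by positivity) hDL hLd fun E hE r hr hrδ hdiam => ?_
  rcases E.eq_empty_or_nonempty with rfl | hne
  · exact ⟨Empty, inferInstance, fun _ => ∅, by simp; positivity, by simp, by simp⟩
  · obtain ⟨u, hu, h⟩ := happ E hE hne fun v hv w hw => (hdiam v hv w hw).trans hrδ
    exact exists_cover_image_of_approximatesLinearOn h hr hdiam hne hD (hdet u hu) (hL u hu) le_rfl

/-- A compact set on which a `C¹` map is infinitesimally contracting, and which the map covers,
has dimension zero. -/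
theorem dimH_eq_zero_of_norm_fderiv_lt_one {V : Type*} [NormedAddCommGroup V] [NormedSpace ℝ V]
    {K : Set V} (hK : IsCompact K) {F : V → V}
    (hF : ContDiff ℝ 1 F) (hKF : K ⊆ F '' K) (hlt : ∀ u ∈ K, ‖fderiv ℝ F u‖ < 1) :
    dimH K = 0 := by
  rcases K.eq_empty_or_nonempty with rfl | hKne
  · exact dimH_empty
  obtain ⟨u₀, hu₀, hmax⟩ := hK.exists_isMaxOn hKne
    (hF.continuous_fderiv one_ne_zero).norm.continuousOn
  set k := ‖fderiv ℝ F u₀‖ with hk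
  have hk1 : k < 1 := hlt u₀ hu₀
  have hk0 : 0 ≤ k := norm_nonneg _
  have hc : 0 < (1 - k) / 2 := by linarith
  obtain ⟨δ, hδ, happ⟩ := exists_approximatesLinearOn_of_isCompact hK hF
    (c := ⟨(1 - k) / 2, hc.le⟩) hc
  have hρ0 : 0 < (1 + k) / 2 := by linarith
  have hρ1 : (1 + k) / 2 < 1 := by linarith
  -- Each piece has a single image piece, so N = 1 and N ρ^d < 1 for every positive d.
  suffices h : ∀ d : ℝ≥0, 0 < d → dimH K ≤ d by
    refine le_antisymm (ENNReal.le_of_forall_pos_le_add fun ε hε _ => ?_) zero_le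
    rw [zero_add]
    exact h ε hε
  intro d hd
  refine dimH_le_of_image_cover hK hKF hδ hρ0 hρ1 (N := 1)
    (by rw [one_mul]; exact Real.rpow_lt_one hρ0.le hρ1 hd) fun E hE r hr hrδ hdiam => ?_
  refine ⟨Unit, inferInstance, fun _ => F '' E, by simp,
    Set.subset_iUnion (fun _ : Unit => F '' E) (), ?_⟩
  rintro - _ ⟨v, hv, rfl⟩ _ ⟨w, hw, rfl⟩
  obtain ⟨u, hu, h⟩ := happ E hE ⟨v, hv⟩ fun v hv w hw => (hdiam v hv w hw).trans hrδ
  have h1 : ‖F v - F w - fderiv ℝ F u (v - w)‖ ≤ (1 - k) / 2 * ‖v - w‖ := h v hv w hw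
  have h2 : ‖fderiv ℝ F u (v - w)‖ ≤ k * ‖v - w‖ :=
    (ContinuousLinearMap.le_opNorm _ _).trans (by gcongr; exact hmax hu)
  have h3 : ‖v - w‖ ≤ r := by rw [← dist_eq_norm]; exact hdiam v hv w hw
  rw [dist_eq_norm]
  calc ‖F v - F w‖ = ‖(F v - F w - fderiv ℝ F u (v - w)) + fderiv ℝ F u (v - w)‖ := by
        rw [sub_add_cancel]
    _ ≤ (1 - k) / 2 * ‖v - w‖ + k * ‖v - w‖ := (norm_add_le _ _).trans (add_le_add h1 h2)
    _ = (1 + k) / 2 * ‖v - w‖ := by ring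
    _ ≤ (1 + k) / 2 * r := by gcongr

end Covering

/-! ### Hausdorff and Lyapunov dimension of invariant sets -/

section LyapunovDimension

theorem IsBoundedInvariant.isCompact {φ : Plane → Plane} {K : Set Plane}
    (hK : IsBoundedInvariant φ K) : IsCompact K :=
  Metric.isCompact_of_isClosed_isBounded hK.isClosed hK.isBounded

theorem IsBoundedInvariant.mapsTo {φ : Plane → Plane} {K : Set Plane}
    (hK : IsBoundedInvariant φ K) : Set.MapsTo φ K K := fun u hu => by
  have h := hK.image_iterate 1
  rw [Function.iterate_one] at h
  exact h ▸ Set.mem_image_of_mem φ hu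

theorem IsBoundedInvariant.exists_preimage {φ : Plane → Plane} {K : Set Plane}
    (hK : IsBoundedInvariant φ K) {u : Plane} (hu : u ∈ K) : ∃ w ∈ K, φ w = u := by
  have h := hK.image_iterate 1
  rw [Function.iterate_one] at h
  rw [← h] at hu
  exact hu

theorem contDiff_iterate {φ : Plane → Plane} (hφ : ContDiff ℝ 1 φ) (n : ℕ) :
    ContDiff ℝ 1 φ^[n] := by
  induction n with
  | zero => exact contDiff_id
  | succ n ih => exact ih.comp hφ

theorem sing_fundamental_mul (a : ℝ) {b : ℝ} (hb : 0 < b) (t : ℕ) (u : Plane) :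
    sing (fundamental (henonMap a b) t u) 0 * sing (fundamental (henonMap a b) t u) 1 = b ^ t := by
  rw [sing_zero_mul_sing_one, abs_det_fundamental_henonMap, abs_of_pos hb]

theorem sing_fundamental_zero_pos (a : ℝ) {b : ℝ} (hb : 0 < b) (t : ℕ) (u : Plane) :
    0 < sing (fundamental (henonMap a b) t u) 0 := by
  have h := sing_fundamental_mul a hb t u
  refine (sing_nonneg _ 0).lt_of_ne fun h0 => ?_
  rw [← h0, zero_mul] at h
  exact (pow_pos hb t).ne h

/-- The two finite-time exponents of the Hénon map add up to `ln b`. -/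
theorem lyapunovExponent_add (a : ℝ) {b : ℝ} (hb : 0 < b) {t : ℕ} (ht : t ≠ 0) (u : Plane) :
    lyapunovExponent (henonMap a b) t u 0 + lyapunovExponent (henonMap a b) t u 1 =
      Real.log b := by
  have h := sing_fundamental_mul a hb t u
  have h0 := sing_fundamental_zero_pos a hb t u
  have h1 : sing (fundamental (henonMap a b) t u) 1 ≠ 0 := by
    intro h1
    rw [h1, mul_zero] at h
    exact (pow_pos hb t).ne h
  have htR : (t : ℝ) ≠ 0 := Nat.cast_ne_zero.2 ht
  rw [lyapunovExponent, lyapunovExponent, ← mul_add, ← Real.log_mul h0.ne' h1, h, Real.log_pow]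
  field_simp

/-- Since λ₁ + λ₂ = ln b < 0, the Kaplan–Yorke index is never 2; it is 1 or 0 according to the sign
of λ₁, and in the first case |λ₂| = λ₁ - ln b. -/
theorem localLyapunovDim_henonMap (a : ℝ) {b : ℝ} (hb : 0 < b) (hb1 : b < 1) {t : ℕ} (ht : t ≠ 0)
    (u : Plane) :
    localLyapunovDim (henonMap a b) t u =
      if 0 ≤ lyapunovExponent (henonMap a b) t u 0 then
        1 + lyapunovExponent (henonMap a b) t u 0 /
          (lyapunovExponent (henonMap a b) t u 0 - Real.log b)
      else 0 := by
  have hadd := lyapunovExponent_add a hb ht u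
  have hlog : Real.log b < 0 := Real.log_neg hb hb1
  rw [localLyapunovDim]
  set l := lyapunovExponent (henonMap a b) t u
  have hneg : ¬ 0 ≤ l 0 + l 1 := by rw [hadd]; exact hlog.not_ge
  split_ifs with h
  · have hi : kaplanYorkeIndex 2 l = 1 := by
      simp [kaplanYorkeIndex, Nat.findGreatest, Finset.sum_range_succ, h, hneg]
    have h1 : |l 1| = l 0 - Real.log b := by
      rw [abs_of_neg (by linarith)]
      linarith
    rw [kaplanYorke, hi, if_neg (by norm_num), Finset.sum_range_one, h1, Nat.cast_one]
  · have hi : kaplanYorkeIndex 2 l = 0 := by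
      simp [kaplanYorkeIndex, Nat.findGreatest, Finset.sum_range_succ, h, hneg]
    rw [kaplanYorke, hi, if_neg (by norm_num)]
    simp

/-- Going from time t to k t raises l and D to the power k but leaves the covering constants 16 and
3 alone, so the strict inequalities absorb them for large k. -/
theorem exists_pow_mul_rpow_lt_one {l D d : ℝ} (hl : 0 < l) (hD : 0 < D) (hDl : D / l < 1)
    (h : l ^ 2 / D * (D / l) ^ d < 1) :
    ∃ k : ℕ, 3 * (D ^ k / l ^ k) < 1 ∧
      16 * (l ^ k) ^ 2 / D ^ k * (3 * (D ^ k / l ^ k)) ^ d < 1 := by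
  have h1 : Tendsto (fun k : ℕ => 3 * (D / l) ^ k) atTop (𝓝 (3 * 0)) :=
    (tendsto_pow_atTop_nhds_zero_of_lt_one (by positivity) hDl).const_mul 3
  have h2 : Tendsto (fun k : ℕ => 16 * 3 ^ d * (l ^ 2 / D * (D / l) ^ d) ^ k) atTop
      (𝓝 (16 * 3 ^ d * 0)) :=
    (tendsto_pow_atTop_nhds_zero_of_lt_one (by positivity) h).const_mul _
  obtain ⟨k, hk1, hk2⟩ := ((h1.eventually_lt_const (u := 1) (by norm_num)).and
    (h2.eventually_lt_const (u := 1) (by norm_num))).exists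
  refine ⟨k, by rwa [← div_pow], ?_⟩
  refine lt_of_eq_of_lt ?_ hk2
  rw [← div_pow, Real.mul_rpow (by norm_num) (by positivity), mul_pow, div_pow (l ^ 2),
    ← Real.rpow_natCast ((D / l) ^ d), ← Real.rpow_natCast (D / l), ← Real.rpow_mul (by positivity),
    ← Real.rpow_mul (by positivity), mul_comm (k : ℝ), ← pow_mul, ← pow_mul, mul_comm k]
  ring

/-- If all exponents at one time `t` satisfy `λ₁ ≤ (s / (1 - s)) |ln b|`, then the dimension is at
most `1 + s'` for every `s' > s`. -/
theorem dimH_le_of_lyapunovExponent_le (a : ℝ) {b : ℝ} (hb : 0 < b) (hb1 : b < 1) {K : Set Plane}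
    (hK : IsBoundedInvariant (henonMap a b) K) {t : ℕ} (ht : t ≠ 0) {s : ℝ} (hs0 : 0 < s)
    (hs1 : s < 1) {d : ℝ≥0} (hsd : 1 + s < d)
    (h : ∀ u ∈ K, lyapunovExponent (henonMap a b) t u 0 ≤ s / (1 - s) * -Real.log b) :
    dimH K ≤ d := by
  set φ := henonMap a b
  have hφ : ContDiff ℝ 1 φ := contDiff_henonMap a b
  have hφd : Differentiable ℝ φ := hφ.differentiable one_ne_zero
  set g := s / (1 - s)
  have hs1' : 0 < 1 - s := by linarith
  have hg : 0 < g := div_pos hs0 hs1'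
  have hgs : g * (1 - s) = s := div_mul_cancel₀ _ hs1'.ne'
  have ht0 : 0 < (t : ℝ) := Nat.cast_pos.2 (Nat.pos_of_ne_zero ht)
  have hβ : 0 < -Real.log b := neg_pos.2 (Real.log_neg hb hb1)
  set B := (t : ℝ) * -Real.log b
  have hB : 0 < B := mul_pos ht0 hβ
  have hL : ∀ u ∈ K, ‖fundamental φ t u‖ ≤ Real.exp (B * g) := by
    intro u hu
    have h0 := sing_fundamental_zero_pos a hb t u
    rw [← sing_zero_eq_norm, ← Real.log_le_iff_le_exp h0]
    have h1 := h u hu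
    rw [lyapunovExponent, one_div, inv_mul_le_iff₀ ht0] at h1
    refine h1.trans_eq ?_
    ring
  have hbt : b ^ t = Real.exp (-B) := by
    rw [← Real.exp_log (pow_pos hb t), Real.log_pow]
    congr 1
    ring
  have hdiv : b ^ t / Real.exp (B * g) = Real.exp (-(B * (1 + g))) := by
    rw [hbt, ← Real.exp_sub]
    congr 1
    ring
  obtain ⟨k, hk1, hk2⟩ := exists_pow_mul_rpow_lt_one (l := Real.exp (B * g)) (D := b ^ t)
    (d := d) (Real.exp_pos _) (pow_pos hb t)
    (by
      rw [hdiv, Real.exp_lt_one_iff]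
      nlinarith [mul_pos hB hg])
    (by
      rw [hdiv, hbt, ← Real.exp_mul, ← Real.exp_nat_mul, ← Real.exp_sub, ← Real.exp_add,
        Real.exp_lt_one_iff]
      -- The exponent to be shown negative is B (1 + 2 g - (1 + g) d). As 1 + g = 1 / (1 - s), its
      -- zero is exactly d = 1 + s.
      have h1 : (1 + g) * (1 + s) = 1 + 2 * g := by linarith
      have h2 : (1 + g) * (1 + s) < (1 + g) * d := by gcongr
      push_cast
      nlinarith)
  refine dimH_le_of_abs_det_fderiv_eq hK.isCompact (contDiff_iterate hφ (k * t))
    (hK.image_iterate (k * t)).ge (by positivity) (by positivity) (fun u hu => ?_) (fun u hu => ?_)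
    hk1 hk2
  · rw [← fundamental_eq_fderiv_iterate hφd]
    exact norm_fundamental_mul_le hφd hK.mapsTo hL k u hu
  · rw [← fundamental_eq_fderiv_iterate hφd, abs_det_fundamental_henonMap, abs_of_pos hb, mul_comm,
      pow_mul]

/-- The Hausdorff dimension of an invariant set of the Hénon map is at most its Lyapunov
dimension. -/
theorem dimH_le_lyapunovDim_henonMap (a : ℝ) {b : ℝ} (hb : 0 < b) (hb1 : b < 1) {K : Set Plane}
    (hK : IsBoundedInvariant (henonMap a b) K) : dimH K ≤ lyapunovDim (henonMap a b) K := by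
  by_contra! hlt
  obtain ⟨c, hc, hcK⟩ := ENNReal.lt_iff_exists_nnreal_btwn.1 hlt
  obtain ⟨t, hfin, ht⟩ := ((frequently_lt_of_liminf_lt (by isBoundedDefault) hc).and_eventually
    (eventually_ne_atTop 0)).exists
  have hloc : ∀ u ∈ K, localLyapunovDim (henonMap a b) t u < c := by
    intro u hu
    have h1 : ENNReal.ofReal (localLyapunovDim (henonMap a b) t u) < c :=
      (le_iSup₂_of_le u hu le_rfl).trans_lt hfin
    by_contra! h2
    exact h1.not_ge (by simpa using ENNReal.ofReal_le_ofReal h2)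
  have hlog : Real.log b < 0 := Real.log_neg hb hb1
  have hφ := contDiff_henonMap a b
  rcases le_or_gt (c : ℝ) 1 with hc1 | hc1
  -- Local dimensions never lie strictly between 0 and 1. Being below c ≤ 1 they all vanish, which
  -- means σ₁(t, u) < 1 on K.
  · have hzero : dimH K = 0 := by
      refine dimH_eq_zero_of_norm_fderiv_lt_one hK.isCompact (contDiff_iterate hφ t)
        (hK.image_iterate t).ge fun u hu => ?_
      have h1 := hloc u hu
      rw [localLyapunovDim_henonMap a hb hb1 ht] at h1
      split_ifs at h1 with h2
      · have : 0 ≤ lyapunovExponent (henonMap a b) t u 0 /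
          (lyapunovExponent (henonMap a b) t u 0 - Real.log b) := div_nonneg h2 (by linarith)
        linarith
      · rw [← fundamental_eq_fderiv_iterate (hφ.differentiable one_ne_zero), ← sing_zero_eq_norm]
        by_contra! h3
        exact h2 (mul_nonneg (by positivity) (Real.log_nonneg h3))
    rw [hzero] at hcK
    exact not_lt_zero hcK
  -- A value d strictly between c and dimH K supplies the strict inequality 1 + s < d with s = c -
  -- 1; the ambient dimension gives c < 2, that is s < 1.
  · obtain ⟨d, hcd, hdK⟩ := ENNReal.lt_iff_exists_nnreal_btwn.1 hcK
    have hcd' : (c : ℝ) < d := by exact_mod_cast hcd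
    have h2 : dimH K ≤ 2 := by
      refine (dimH_mono (Set.subset_univ K)).trans ?_
      rw [Real.dimH_univ_eq_finrank, finrank_plane, Nat.cast_ofNat]
    have hc2 : (c : ℝ) < 2 := by exact_mod_cast hcK.trans_le h2
    refine hdK.not_ge (dimH_le_of_lyapunovExponent_le a hb hb1 hK ht (s := c - 1)
      (by linarith) (by linarith) (by linarith) fun u hu => ?_)
    have h1 := hloc u hu
    rw [localLyapunovDim_henonMap a hb hb1 ht] at h1
    have hpos : 0 < 1 - ((c : ℝ) - 1) := by linarith
    rw [div_mul_eq_mul_div, le_div_iff₀ hpos]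
    split_ifs at h1 with h3
    · have h4 : lyapunovExponent (henonMap a b) t u 0 /
          (lyapunovExponent (henonMap a b) t u 0 - Real.log b) < c - 1 := by linarith
      rw [div_lt_iff₀ (by linarith)] at h4
      linarith
    · push Not at h3
      nlinarith

theorem one_lt_sigmaOne (b : ℝ) {x : ℝ} (hx : 0 < x) : 1 < sigmaOne b x := by
  have h1 : 1 + |b| < √(4 * x ^ 2 + (1 + |b|) ^ 2) := Real.lt_sqrt_of_sq_lt (by nlinarith)
  have h2 : 1 - |b| < √(4 * x ^ 2 + (1 - |b|) ^ 2) := Real.lt_sqrt_of_sq_lt (by nlinarith)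
  unfold sigmaOne
  linarith

/-- A bound of `|x|` on an invariant set bounds its Lyapunov dimension. -/
theorem lyapunovDim_henonMap_le (a : ℝ) {b : ℝ} (hb : 0 < b) (hb1 : b < 1) {K : Set Plane}
    (hK : IsBoundedInvariant (henonMap a b) K) {X : ℝ} (hX : 0 < X) (hKX : ∀ u ∈ K, |u 0| ≤ X) :
    lyapunovDim (henonMap a b) K ≤
      ENNReal.ofReal (1 + (1 - Real.log b / Real.log (sigmaOne b X))⁻¹) := by
  have hlog : Real.log b < 0 := Real.log_neg hb hb1
  have hσ := one_lt_sigmaOne b hX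
  have hΛ := Real.log_pos hσ
  have hnorm : ∀ u ∈ K, ‖fundamental (henonMap a b) 1 u‖ ≤ sigmaOne b X := by
    intro u hu
    have h1 : fundamental (henonMap a b) 1 u = henonDeriv b u := by
      simp [fundamental, fderiv_henonMap]
    rw [h1, ← sing_zero_eq_norm, (sing_henonDeriv b u).1]
    exact sigmaOne_le_sigmaOne ((hKX u hu).trans (le_abs_self X))
  have hval : (1 - Real.log b / Real.log (sigmaOne b X))⁻¹ =
      Real.log (sigmaOne b X) / (Real.log (sigmaOne b X) - Real.log b) := by
    rw [one_sub_div hΛ.ne', inv_div]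
  have hev : ∀ᶠ t : ℕ in atTop, finiteTimeLyapunovDim (henonMap a b) t K ≤
      ENNReal.ofReal (1 + (1 - Real.log b / Real.log (sigmaOne b X))⁻¹) := by
    filter_upwards [eventually_ne_atTop 0] with t ht
    refine iSup₂_le fun u hu => ENNReal.ofReal_le_ofReal ?_
    have ht0 : 0 < (t : ℝ) := Nat.cast_pos.2 (Nat.pos_of_ne_zero ht)
    have hexp : lyapunovExponent (henonMap a b) t u 0 ≤ Real.log (sigmaOne b X) := by
      have h1 := norm_fundamental_mul_le ((contDiff_henonMap a b).differentiable one_ne_zero)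
        hK.mapsTo hnorm t u hu
      rw [mul_one, ← sing_zero_eq_norm] at h1
      rw [lyapunovExponent, one_div, inv_mul_le_iff₀ ht0, ← Real.log_pow]
      exact Real.log_le_log (sing_fundamental_zero_pos a hb t u) h1
    rw [localLyapunovDim_henonMap a hb hb1 ht, hval]
    split_ifs with h
    · gcongr 1 + ?_
      -- Monotonicity of λ / (λ - ln b) in λ ≥ 0, by cross-multiplication.
      rw [div_le_div_iff₀ (by linarith) (by linarith)]
      nlinarith
    · have : 0 < Real.log (sigmaOne b X) / (Real.log (sigmaOne b X) - Real.log b) :=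
        div_pos hΛ (by linarith)
      linarith
  exact (liminf_le_liminf hev).trans_eq (liminf_const _)

end LyapunovDimension

/-! ### Localization of invariant sets and the classical parameters -/

section Localization

theorem feitRadius_pos (a b : ℝ) : 0 < feitRadius a b := by
  refine lt_max_of_lt_left ?_
  have := Real.sqrt_nonneg (1 + 4 * a)
  unfold feitR
  linarith

theorem le_of_mem_feitRegion {a b : ℝ} {u : Plane} (hu : u ∈ feitRegion a b) :
    u 0 ≤ feitM a b ∧ u 1 ≤ feitM a b + a := by
  have hc : ∀ i : Fin 2, Continuous fun v : Plane => v i := fun i => by fun_prop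
  have hclosed : IsClosed {v : Plane | v 0 ≤ feitM a b ∧ v 1 ≤ feitM a b + a} :=
    (isClosed_le (hc 0) continuous_const).inter (isClosed_le (hc 1) continuous_const)
  exact closure_minimal (t := {v : Plane | v 0 ≤ feitM a b ∧ v 1 ≤ feitM a b + a})
    (fun v hv => ⟨hv.1.le, hv.2.le⟩) hclosed hu.1

/-- The right bound is that of the closure of M. The left one comes from excluding R₁, whose
condition on y holds automatically in the closure of M. -/
theorem abs_le_feitRadius_of_mem_feitRegion {a b : ℝ} {u : Plane} (hu : u ∈ feitRegion a b) :
    |u 0| ≤ feitRadius a b := by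
  obtain ⟨h0, h1⟩ := le_of_mem_feitRegion hu
  refine abs_le.2 ⟨?_, h0.trans (le_max_of_le_right (le_max_left _ _))⟩
  by_contra! h
  refine hu.2 (Or.inl (Or.inr ⟨h.trans_le ?_, h1⟩))
  exact neg_le_neg (le_max_of_le_right (le_max_right _ _))

theorem feitR_le_of_mem_feitRegion {a b : ℝ} {u : Plane} (hu : u ∈ feitRegion a b)
    (h : u 1 < 0) : feitR a ≤ u 0 := by
  by_contra! h0
  exact hu.2 (Or.inl (Or.inl ⟨h0, h⟩))

/-- The first coordinate is at most `1.83` on bounded invariant sets of the classical Hénon map. -/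
theorem le_of_mem_isBoundedInvariant {K : Set Plane}
    (hK : IsBoundedInvariant (henonMap 1.4 0.3) K) {u : Plane} (hu : u ∈ K) : u 0 ≤ 1.83 := by
  have hc : Continuous fun v : Plane => v 0 := by fun_prop
  -- Take a point with maximal x and three successive preimages z ← w ← v ← y. The y-coordinate of a
  -- point is the x-coordinate of its preimage, so the orbit obeys a second-order recurrence in x.
  obtain ⟨z, hz, hmax⟩ := hK.isCompact.exists_isMaxOn hK.nonempty hc.continuousOn
  have hmax' : ∀ v ∈ K, v 0 ≤ z 0 := fun v hv => hmax hv
  refine (hmax' u hu).trans ?_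
  obtain ⟨w, hw, hwz⟩ := hK.exists_preimage hz
  obtain ⟨v, hv, hvw⟩ := hK.exists_preimage hw
  obtain ⟨y, hy, hyv⟩ := hK.exists_preimage hv
  have e1 : z 0 = 1.4 + 0.3 * v 0 - w 0 ^ 2 := by simp [← hwz, ← hvw, henonMap]
  have e2 : w 0 = 1.4 + 0.3 * y 0 - v 0 ^ 2 := by simp [← hvw, ← hyv, henonMap]
  have m1 := hmax' v hv
  have m2 := hmax' y hy
  norm_num at e1 e2 ⊢
  -- Maximality in the recurrence gives x ≤ 1.4 + 0.3 x at the maximum.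
  have hz2 : z 0 ≤ 2 := by nlinarith [sq_nonneg (w 0)]
  -- If v 0 ≤ 1.43, then z 0 ≤ 1.4 + 0.3 · 1.43 = 1.829. Otherwise w 0 ≤ 2 - (v 0)² is negative, and
  -- the term -(w 0)² outweighs the gain in 0.3 v 0.
  rcases le_or_gt (v 0) 1.43 with h | h
  · norm_num at h
    nlinarith [sq_nonneg (w 0)]
  · norm_num at h
    -- The left side is the tangent line of x² - 2 at x = 1.43.
    have h1 : 0.0449 + 2.86 * (v 0 - 1.43) ≤ -w 0 := by
      norm_num
      nlinarith [sq_nonneg (v 0 - 143 / 100)]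
    have h2 : (0.0449 + 2.86 * (v 0 - 1.43)) ^ 2 ≤ (w 0) ^ 2 := by
      rw [← neg_sq (w 0)]
      refine pow_le_pow_left₀ ?_ h1 2
      norm_num
      linarith
    norm_num at h2
    nlinarith [sq_nonneg (v 0 - 143 / 100)]

/-- The first coordinate is at most `1.89` in modulus on invariant subsets of Feit's region of the
classical Hénon map. -/
theorem abs_le_of_subset_feitRegion {K : Set Plane}
    (hK : IsBoundedInvariant (henonMap 1.4 0.3) K) (hsub : K ⊆ feitRegion 1.4 0.3) {u : Plane}
    (hu : u ∈ K) : |u 0| ≤ 1.89 := by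
  have hle := le_of_mem_isBoundedInvariant hK hu
  refine abs_le.2 ⟨?_, hle.trans (by norm_num)⟩
  by_contra! h
  obtain ⟨w, hw, hwu⟩ := hK.exists_preimage hu
  have e0 : u 1 ≤ 1.83 := by
    have := le_of_mem_isBoundedInvariant hK hw
    simpa [← hwu, henonMap] using this
  have hv := hK.mapsTo hu
  have hz := hK.mapsTo hv
  set v := henonMap 1.4 0.3 u with hvdef
  set z := henonMap 1.4 0.3 v with hzdef
  have e1 : v 0 = 1.4 + 0.3 * u 1 - u 0 ^ 2 := by simp [hvdef, henonMap]
  have e2 : v 1 = u 0 := by simp [hvdef, henonMap]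
  have e3 : z 0 = 1.4 + 0.3 * v 1 - v 0 ^ 2 := by simp [hzdef, henonMap]
  have e4 : z 1 = v 0 := by simp [hzdef, henonMap]
  norm_num at h e0 e1 e3
  -- The constant is 1.4 + 0.3 · 1.83 - 1.89².
  have hv0 : v 0 ≤ -1.6231 := by
    norm_num
    nlinarith
  -- From 1.4 - 0.3 · 1.89 - 1.6231² < -1.8. As r > -1.79 and z 1 = v 0 < 0, the point z lies in Q,
  -- which the region excludes.
  have hz0 : z 0 < -1.8 := by
    norm_num at hv0 ⊢
    rw [e2] at e3
    nlinarith
  have hr := feitR_le_of_mem_feitRegion (hsub hz) (by rw [e4]; linarith)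
  have hsq : √(1 + 4 * 1.4) < 2.58 := (Real.sqrt_lt' (by norm_num)).2 (by norm_num)
  unfold feitR at hr
  norm_num at hr hsq hz0
  linarith

theorem sigmaOne_le : sigmaOne 0.3 1.89 ≤ 3.921 := by
  have h1 : √(4 * 1.89 ^ 2 + (1 + |(0.3 : ℝ)|) ^ 2) ≤ 3.9974 :=
    Real.sqrt_le_iff.2 ⟨by norm_num, by rw [abs_of_pos (by norm_num)]; norm_num⟩
  have h2 : √(4 * 1.89 ^ 2 + (1 - |(0.3 : ℝ)|) ^ 2) ≤ 3.8446 :=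
    Real.sqrt_le_iff.2 ⟨by norm_num, by rw [abs_of_pos (by norm_num)]; norm_num⟩
  unfold sigmaOne
  linarith

/-- The target dimension 1.5319 needs ln σ₁ / (-ln b) ≤ 0.5319 / 0.4681 ≈ 1.1363. The fraction 42 /
37 ≈ 1.1351 lies just below that, and turns the estimate into a comparison of integer powers of
rationals. -/
theorem log_sigmaOne_le : 37 * Real.log (sigmaOne 0.3 1.89) ≤ 42 * -Real.log 0.3 := by
  have h0 : 0 < sigmaOne 0.3 1.89 := zero_lt_one.trans_le (one_le_sigmaOne _ _)
  have h1 : sigmaOne 0.3 1.89 ^ 37 ≤ (0.3⁻¹ : ℝ) ^ 42 :=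
    (pow_le_pow_left₀ h0.le sigmaOne_le 37).trans (by norm_num)
  have h2 := Real.log_le_log (by positivity) h1
  rw [Real.log_pow, Real.log_pow, Real.log_inv] at h2
  exact_mod_cast h2

theorem kaplanYorke_bound_le :
    1 + (1 - Real.log 0.3 / Real.log (sigmaOne 0.3 1.89))⁻¹ ≤ 1.5319 := by
  have hΛ := Real.log_pos (one_lt_sigmaOne 0.3 (x := 1.89) (by norm_num))
  have hlog : Real.log 0.3 < 0 := Real.log_neg (by norm_num) (by norm_num)
  have h := log_sigmaOne_le
  have h1 : (1 - Real.log 0.3 / Real.log (sigmaOne 0.3 1.89))⁻¹ ≤ 0.5319 := by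
    rw [one_sub_div hΛ.ne', inv_div, div_le_iff₀ (by linarith)]
    norm_num at h hlog ⊢
    linarith
  norm_num at h1 ⊢
  linarith

end Localization

end Henon

theorem mainTheorem2 :
    (∀ a b : ℝ, b ≠ 0 → |b| < 1 → ∀ u : Henon.Plane,
      Henon.sing (fderiv ℝ (Henon.henonMap a b) u) 0 = Henon.sigmaOne b (u 0) ∧
      Henon.sing (fderiv ℝ (Henon.henonMap a b) u) 1 = |b| / Henon.sigmaOne b (u 0) ∧
      1 ≤ Henon.sigmaOne b (u 0) ∧
      |b| / Henon.sigmaOne b (u 0) ≤ |b|) ∧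
    (∀ a b : ℝ, 0 < a → 0 < b → b < 1 → ∀ K : Set Henon.Plane,
      Henon.IsBoundedInvariant (Henon.henonMap a b) K → K ⊆ Henon.feitRegion a b →
      dimH K ≤ Henon.lyapunovDim (Henon.henonMap a b) K ∧
      Henon.lyapunovDim (Henon.henonMap a b) K ≤
        ENNReal.ofReal (1 + (1 - Real.log b /
          Real.log (Henon.sigmaOne b (Henon.feitRadius a b)))⁻¹)) ∧
    (∀ K : Set Henon.Plane,
      Henon.IsBoundedInvariant (Henon.henonMap 1.4 0.3) K → K ⊆ Henon.feitRegion 1.4 0.3 →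
      dimH K ≤ Henon.lyapunovDim (Henon.henonMap 1.4 0.3) K ∧
      Henon.lyapunovDim (Henon.henonMap 1.4 0.3) K ≤ ENNReal.ofReal 1.5319) := by
  refine ⟨fun a b _ _ u => Henon.henon_singular_values a b u, fun a b _ hb hb1 K hK hsub => ?_,
    fun K hK hsub => ?_⟩
  · exact ⟨Henon.dimH_le_lyapunovDim_henonMap a hb hb1 hK,
      Henon.lyapunovDim_henonMap_le a hb hb1 hK (Henon.feitRadius_pos a b)
        fun u hu => Henon.abs_le_feitRadius_of_mem_feitRegion (hsub hu)⟩
  -- For these parameters `feitRadius` is m = 3.2, which gives only about 1.61; hence the sharper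
  -- bound 1.89.
  · have h0 : (0 : ℝ) < 0.3 := by norm_num
    have h1 : (0.3 : ℝ) < 1 := by norm_num
    exact ⟨Henon.dimH_le_lyapunovDim_henonMap 1.4 h0 h1 hK,
      (Henon.lyapunovDim_henonMap_le 1.4 h0 h1 hK (X := 1.89) (by norm_num)
        fun u hu => Henon.abs_le_of_subset_feitRegion hK hsub hu).trans
        (ENNReal.ofReal_le_ofReal Henon.kaplanYorke_bound_le)⟩
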